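/- **Definitions.** For rationals in lowest terms put $\frac ab\oplus\frac cd=\frac{a+c}{b+d}$ (Farey mediant) and $\frac{p_1}{q_1}*\frac{p_2}{q_2}=\frac{p_1q_1+p_2q_2}{q_1^2+q_2^2}$ (Springborn mediant). Springborn's function $\mu$ on $\mathbb Q\cap[0,1]$ is determined by $\mu(0)=0$, $\mu(1)=\frac12$ and $\mu\left(\frac ab\oplus\frac cd\right)=\mu\left(\frac ab\right)*\mu\left(\frac cd\right)$ whenever $|ad-bc|=1$. For $\frac ab\in\mathbb Q\cap[0,1]$ let $q\left(\frac ab\right)$ be the denominator of $\mu\left(\frac ab\right)$ in lowest terms (a Markov number). Extend $\mu$ to real $x\in[0,1]$ by $\mu(x)=\lim_{r\to x,\ r\in\mathbb Q\cap[0,1]}\mu(r)$ for irrational $x$. Let $$l(q)=3-\frac{\sqrt{9q^2-4}}{q},\qquad H(x)=\begin{cases}0,&x<0,\\ \tfrac12,&x=0,\\ 1,&x>0.\end{cases}$$ The saltus function of a monotone function $f$ on $[0,1]$ is $$s_f(x)=\bigl(f(x)-f(x^-)\bigr)+\sum_{y<x}\bigl(f(y^+)-f(y^-)\bigr),\qquad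 f(0^-):=f(0),$$ where $f(y^\pm)$ are the one-sided limits. **Proposition 4.1.** The limits defining $\mu$ at irrational points exist, $\mu$ is strictly increasing on $[0,1]$, and it coincides with its saltus function: for every real $x\in[0,1]$, $$\mu(x)=s_\mu(x)=-\frac12\,l(1)+\sum_{a/b\in\mathbb Q\cap[0,1]}l\!\left(q\!\left(\tfrac ab\right)\right)H\!\left(x-\tfrac ab\right),$$ where the series converges absolutely. -/

import Mathlib

open Set Filter Topology

/-- The Farey mediant `a/b ⊕ c/d = (a + c)/(b + d)` of two rationals in lowest terms. -/
def fareyMediant (x y : ℚ) : ℚ :=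
  ((x.num + y.num : ℤ) : ℚ) / ((x.den + y.den : ℕ) : ℚ)

/-- The Springborn mediant `p₁/q₁ * p₂/q₂ = (p₁ q₁ + p₂ q₂)/(q₁² + q₂²)` of two rationals in
lowest terms. -/
def springbornMediant (x y : ℚ) : ℚ :=
  ((x.num * x.den + y.num * y.den : ℤ) : ℚ) / ((x.den ^ 2 + y.den ^ 2 : ℕ) : ℚ)

/-- Simultaneous descent in the Farey tree and in the Markov fraction tree. The Farey neighbours
`xl < xr` carry the Markov fractions `ml` and `mr`, and `x` lies in `[xl, xr]`. At an endpoint the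
label is returned; otherwise the descent goes on in one of the two halves of `[xl, xr]` cut by the
Farey mediant, which is labelled by the Springborn mediant. The first argument bounds the number
of steps. -/
def springbornDescent : ℕ → ℚ → ℚ → ℚ → ℚ → ℚ → ℚ
  | 0, _, _, _, _, _ => 0
  | n + 1, x, xl, xr, ml, mr =>
    if x = xl then ml
    else if x = xr then mr
    else if x ≤ fareyMediant xl xr then
      springbornDescent n x xl (fareyMediant xl xr) ml (springbornMediant ml mr)
    else
      springbornDescent n x (fareyMediant xl xr) xr (springbornMediant ml mr) mr

/-- Springborn's function `μ` on the rationals of `[0, 1]` (meaningless outside): the juxtaposition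
of the Farey tree grown from `0/1, 1/1` with the Markov fraction tree grown from `0/1, 1/2`. A
rational with denominator `b` is reached in at most `b` steps; that it is always reached in time
is part of `springbornRat_fareyMediant` below. -/
def springbornRat (x : ℚ) : ℚ :=
  springbornDescent x.den x 0 1 0 (1 / 2)

/-- `x < y` are Farey neighbours: `c b - a d = 1` for `x = a/b` and `y = c/d` in lowest terms. -/
def IsFareyPair (x y : ℚ) : Prop := y.num * x.den - x.num * y.den = 1

theorem IsFareyPair.lt {x y : ℚ} (h : IsFareyPair x y) : x < y := by
  unfold IsFareyPair at h
  rw [Rat.lt_iff]; omega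

theorem IsFareyPair.mediant {x y : ℚ} (h : IsFareyPair x y) :
    (fareyMediant x y).num = x.num + y.num ∧ (fareyMediant x y).den = x.den + y.den := by
  unfold IsFareyPair at h
  have hb : (0 : ℤ) < (x.den : ℤ) + y.den := by have := x.pos; omega
  have hco : Nat.Coprime (x.num + y.num).natAbs ((x.den : ℤ) + y.den).natAbs := by
    rw [← Int.isCoprime_iff_nat_coprime]
    exact ⟨x.den, -x.num, by linear_combination h⟩
  have h1 := Rat.num_div_eq_of_coprime hb hco
  have h2 := Rat.den_div_eq_of_coprime hb hco
  have e : fareyMediant x y = ((x.num + y.num : ℤ) : ℚ) / (((x.den : ℤ) + y.den : ℤ) : ℚ) := by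
    unfold fareyMediant; push_cast; rfl
  rw [e]
  exact ⟨h1, by exact_mod_cast h2⟩

theorem IsFareyPair.left {x y : ℚ} (h : IsFareyPair x y) :
    IsFareyPair x (fareyMediant x y) := by
  obtain ⟨h1, h2⟩ := h.mediant
  unfold IsFareyPair at *
  rw [h1, h2]; push_cast; linear_combination h

theorem IsFareyPair.right {x y : ℚ} (h : IsFareyPair x y) :
    IsFareyPair (fareyMediant x y) y := by
  obtain ⟨h1, h2⟩ := h.mediant
  unfold IsFareyPair at *
  rw [h1, h2]; push_cast; linear_combination h

theorem IsFareyPair.den_le {x y z : ℚ} (h : IsFareyPair x y) (h1 : x < z) (h2 : z < y) :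
    x.den + y.den ≤ z.den := by
  unfold IsFareyPair at h
  rw [Rat.lt_iff] at h1 h2
  have hx := x.pos
  have hy := y.pos
  have hx' : (0 : ℤ) < x.den := by exact_mod_cast hx
  have hy' : (0 : ℤ) < y.den := by exact_mod_cast hy
  have e : (z.den : ℤ) = y.den * (z.num * x.den - x.num * z.den)
      + x.den * (y.num * z.den - z.num * y.den) := by linear_combination -(z.den : ℤ) * h
  have : (x.den : ℤ) + y.den ≤ z.den := by
    rw [e]; nlinarith
  exact_mod_cast this

/-- `n` steps suffice to reach `x` from the Farey pair `xl, xr`. -/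
def EnoughSteps (n : ℕ) (x xl xr : ℚ) : Prop :=
  1 ≤ n ∧ (x = xl ∨ x = xr ∨ x.den + 2 ≤ n + xl.den + xr.den)

theorem springbornDescent_left_end {n : ℕ} (hn : 1 ≤ n) (xl xr ml mr : ℚ) :
    springbornDescent n xl xl xr ml mr = ml := by
  obtain ⟨k, rfl⟩ : ∃ k, n = k + 1 := ⟨n - 1, by omega⟩
  simp [springbornDescent]

theorem springbornDescent_right_end {n : ℕ} (hn : 1 ≤ n) {xl xr : ℚ} (h : xl ≠ xr) (ml mr : ℚ) :
    springbornDescent n xr xl xr ml mr = mr := by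
  obtain ⟨k, rfl⟩ : ∃ k, n = k + 1 := ⟨n - 1, by omega⟩
  simp [springbornDescent, h.symm]

theorem springbornDescent_step_left {n : ℕ} {x xl xr : ℚ} (ml mr : ℚ) (h : IsFareyPair xl xr)
    (h1 : xl ≤ x) (h2 : x ≤ fareyMediant xl xr) (hn : EnoughSteps n x xl xr) :
    ∃ k, EnoughSteps k x xl (fareyMediant xl xr) ∧ springbornDescent n x xl xr ml mr =
      springbornDescent k x xl (fareyMediant xl xr) ml (springbornMediant ml mr) := by
  obtain ⟨hn1, hn2⟩ := hn
  rcases h1.eq_or_lt with rfl | h1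
  · exact ⟨1, ⟨le_rfl, Or.inl rfl⟩, by
      rw [springbornDescent_left_end hn1, springbornDescent_left_end le_rfl]⟩
  have h3 : x < xr := h2.trans_lt h.right.lt
  have hd := h.den_le h1 h3
  have hn3 : x.den + 2 ≤ n + xl.den + xr.den := by
    rcases hn2 with e | e | e
    · exact absurd e h1.ne'
    · exact absurd e h3.ne
    · exact e
  obtain ⟨k, rfl⟩ : ∃ k, n = k + 1 := ⟨n - 1, by omega⟩
  refine ⟨k, ⟨by omega, Or.inr (Or.inr ?_)⟩, ?_⟩
  · rw [h.mediant.2]; have := xl.pos; omega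
  · rw [springbornDescent, if_neg h1.ne', if_neg h3.ne, if_pos h2]

theorem springbornDescent_step_right {n : ℕ} {x xl xr : ℚ} (ml mr : ℚ) (h : IsFareyPair xl xr)
    (h1 : fareyMediant xl xr ≤ x) (h2 : x ≤ xr) (hn : EnoughSteps n x xl xr) :
    ∃ k, EnoughSteps k x (fareyMediant xl xr) xr ∧ springbornDescent n x xl xr ml mr =
      springbornDescent k x (fareyMediant xl xr) xr (springbornMediant ml mr) mr := by
  have hn' := hn
  obtain ⟨hn1, hn2⟩ := hn
  rcases h1.eq_or_lt with rfl | h1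
  · obtain ⟨k, hk, e⟩ := springbornDescent_step_left ml mr h h.left.lt.le le_rfl hn'
    refine ⟨1, ⟨le_rfl, Or.inl rfl⟩, ?_⟩
    rw [e, springbornDescent_right_end hk.1 h.left.lt.ne, springbornDescent_left_end le_rfl]
  rcases h2.eq_or_lt with rfl | h2
  · exact ⟨1, ⟨le_rfl, Or.inr (Or.inl rfl)⟩, by
      rw [springbornDescent_right_end hn1 h.lt.ne,
        springbornDescent_right_end le_rfl h.right.lt.ne]⟩
  have h3 : xl < x := h.left.lt.trans h1
  have hd := h.den_le h3 h2
  have hn3 : x.den + 2 ≤ n + xl.den + xr.den := by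
    rcases hn2 with e | e | e
    · exact absurd e h3.ne'
    · exact absurd e h2.ne
    · exact e
  obtain ⟨k, rfl⟩ : ∃ k, n = k + 1 := ⟨n - 1, by omega⟩
  refine ⟨k, ⟨by omega, Or.inr (Or.inr ?_)⟩, ?_⟩
  · rw [h.mediant.2]; have := xr.pos; omega
  · rw [springbornDescent, if_neg h3.ne', if_neg h2.ne, if_neg h1.not_ge]

theorem springbornDescent_fareyMediant (d : ℕ) {x y : ℚ} (hxy : IsFareyPair x y) :
    ∀ {xl xr : ℚ} (ml mr : ℚ) {n₁ n₂ n₃ : ℕ}, IsFareyPair xl xr → xl ≤ x → y ≤ xr →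
      x.den + y.den ≤ d + xl.den + xr.den →
      EnoughSteps n₁ x xl xr → EnoughSteps n₂ y xl xr →
      EnoughSteps n₃ (fareyMediant x y) xl xr →
      springbornDescent n₃ (fareyMediant x y) xl xr ml mr =
        springbornMediant (springbornDescent n₁ x xl xr ml mr)
          (springbornDescent n₂ y xl xr ml mr) := by
  have key : ∀ {xl xr : ℚ} (ml mr : ℚ) {n₁ n₂ n₃ : ℕ}, IsFareyPair xl xr → x = xl → y = xr →
      EnoughSteps n₁ x xl xr → EnoughSteps n₂ y xl xr →
      EnoughSteps n₃ (fareyMediant x y) xl xr →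
      springbornDescent n₃ (fareyMediant x y) xl xr ml mr =
        springbornMediant (springbornDescent n₁ x xl xr ml mr)
          (springbornDescent n₂ y xl xr ml mr) := by
    rintro xl xr ml mr n₁ n₂ n₃ h rfl rfl h₁ h₂ h₃
    obtain ⟨k, hk, e⟩ := springbornDescent_step_left ml mr h h.left.lt.le le_rfl h₃
    rw [e, springbornDescent_right_end hk.1 h.left.lt.ne, springbornDescent_left_end h₁.1,
      springbornDescent_right_end h₂.1 h.lt.ne]
  induction d with
  | zero =>
    intro xl xr ml mr n₁ n₂ n₃ h hl hr hd h₁ h₂ h₃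
    have ex : x = xl := by
      by_contra hne
      have := h.den_le (lt_of_le_of_ne hl (Ne.symm hne)) (hxy.lt.trans_le hr)
      have := y.pos; omega
    have ey : y = xr := by
      by_contra hne
      have := h.den_le (hl.trans_lt hxy.lt) (lt_of_le_of_ne hr hne)
      have := x.pos; omega
    exact key ml mr h ex ey h₁ h₂ h₃
  | succ d ih =>
    intro xl xr ml mr n₁ n₂ n₃ h hl hr hd h₁ h₂ h₃
    by_cases hends : x = xl ∧ y = xr
    · exact key ml mr h hends.1 hends.2 h₁ h₂ h₃
    have hm := h.mediant.2
    have pl := xl.pos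
    have pr := xr.pos
    rcases le_or_gt y (fareyMediant xl xr) with hy | hy
    · have hz := hxy.right.lt.le.trans hy
      obtain ⟨k₁, hk₁, e₁⟩ :=
        springbornDescent_step_left ml mr h hl (hxy.lt.le.trans hy) h₁
      obtain ⟨k₂, hk₂, e₂⟩ := springbornDescent_step_left ml mr h (hl.trans hxy.lt.le) hy h₂
      obtain ⟨k₃, hk₃, e₃⟩ :=
        springbornDescent_step_left ml mr h (hl.trans hxy.left.lt.le) hz h₃
      rw [e₁, e₂, e₃]
      exact ih _ _ h.left hl hy (by omega) hk₁ hk₂ hk₃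
    · have hx : fareyMediant xl xr ≤ x := by
        by_contra hx
        rw [not_le] at hx
        have h4 := hxy.den_le hx hy
        apply hends
        constructor
        · by_contra hne
          have := h.den_le (lt_of_le_of_ne hl (Ne.symm hne)) (hxy.lt.trans_le hr)
          have := y.pos; omega
        · by_contra hne
          have := h.den_le (hl.trans_lt hxy.lt) (lt_of_le_of_ne hr hne)
          have := x.pos; omega
      obtain ⟨k₁, hk₁, e₁⟩ :=
        springbornDescent_step_right ml mr h hx (hxy.lt.le.trans hr) h₁
      obtain ⟨k₂, hk₂, e₂⟩ :=
        springbornDescent_step_right ml mr h (hx.trans hxy.lt.le) hr h₂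
      obtain ⟨k₃, hk₃, e₃⟩ :=
        springbornDescent_step_right ml mr h (hx.trans hxy.left.lt.le) (hxy.right.lt.le.trans hr) h₃
      rw [e₁, e₂, e₃]
      exact ih _ _ h.right hx hr (by omega) hk₁ hk₂ hk₃

/-- `springbornRat` intertwines the Farey and Springborn mediants of Farey neighbours in
`[0, 1]`: `μ(x ⊕ y) = μ(x) * μ(y)`. -/
theorem springbornRat_fareyMediant {x y : ℚ} (hx : 0 ≤ x) (hy : y ≤ 1) (h : IsFareyPair x y) :
    springbornRat (fareyMediant x y) =
      springbornMediant (springbornRat x) (springbornRat y) := by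
  have steps : ∀ z : ℚ, EnoughSteps z.den z 0 1 := fun z =>
    ⟨z.pos, Or.inr (Or.inr (by simp))⟩
  exact springbornDescent_fareyMediant (x.den + y.den) h 0 (1 / 2) (by simp [IsFareyPair]) hx hy
    (by omega) (steps _) (steps _) (steps _)

theorem springbornRat_zero : springbornRat 0 = 0 := by
  simp [springbornRat, springbornDescent]

theorem springbornRat_one : springbornRat 1 = 1 / 2 := by
  simp [springbornRat, springbornDescent]

/-- The Markov number `q(a/b)` corresponding to `a/b`: the denominator, in lowest terms, of the
Markov fraction `μ(a/b)`. -/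
def markovNumber (x : ℚ) : ℕ := (springbornRat x).den

/-- Springborn's function on `[0, 1]`: the function `springbornRat` at rational points, and the
limit of its values at rationals tending to `x` when `x` is irrational. -/
noncomputable def springborn (x : unitInterval) : ℝ :=
  open Classical in
  if h : ∃ r : ℚ, (r : ℝ) = x then (springbornRat h.choose : ℝ)
  else
    limUnder (comap (fun r : Icc (0 : ℚ) 1 => ((r : ℚ) : ℝ)) (𝓝 (x : ℝ)))
      (fun r : Icc (0 : ℚ) 1 => (springbornRat r : ℝ))

/-- At a rational point `springborn` is `springbornRat`. -/
theorem springborn_ratCast (r : Icc (0 : ℚ) 1) (x : unitInterval) (h : ((r : ℚ) : ℝ) = x) :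
    springborn x = (springbornRat r : ℝ) := by
  have hx : ∃ r : ℚ, (r : ℝ) = x := ⟨r, h⟩
  have e : hx.choose = r := by
    have := hx.choose_spec.trans h.symm
    exact_mod_cast this
  rw [springborn, dif_pos hx, e]

/-- The length `l(q) = 3 - √(9q² - 4)/q` of the gap around a Markov fraction of denominator
`q`. -/
noncomputable def gapLength (q : ℕ) : ℝ := 3 - √(9 * (q : ℝ) ^ 2 - 4) / q

/-- The Heaviside step function with value `1/2` at `0`. -/
noncomputable def heaviside (x : ℝ) : ℝ :=
  if x < 0 then 0 else if x = 0 then 1 / 2 else 1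

/-- The saltus function of a monotone function `f` on `[0, 1]`:
`s_f(x) = (f(x) - f(x⁻)) + ∑_{y < x} (f(y⁺) - f(y⁻))`, with the convention `f(0⁻) = f(0)`, which
`Function.leftLim` on `[0, 1]` observes. The summand is the jump of `f` at `y`; it vanishes at all
but countably many `y`, and the sum converges because `f` is monotone and bounded. -/
noncomputable def saltus (f : unitInterval → ℝ) (x : unitInterval) : ℝ :=
  (f x - Function.leftLim f x) +
    ∑' y : Iio x, (Function.rightLim f (y : unitInterval) - Function.leftLim f (y : unitInterval))

/-!
Two Farey neighbours `x < y` carry Markov fractions `p₁/q₁ < p₂/q₂` for which `q₁`, `q₂` and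
`k = p₂ q₁ - p₁ q₂` solve the Markov equation; this is preserved by the mediants
(`IsMarkovPair.left`, `IsMarkovPair.right`), because the Springborn mediant has the denominator
`3 q₁ q₂ - k` in lowest terms. Solving for `k` gives
`μ(y) - μ(x) = k / (q₁ q₂) = (3 - √(9 - 4/q₁² - 4/q₂²)) / 2`, whereas `l(q) = 3 - √(9 - 4/q²)`.

The *excess* of the interval is `μ(y) - μ(x) - l(q₁)/2 - l(q₂)/2`. It is nonnegative, and of order
`1/(q₁ q₂)²`, hence at most a constant times the gap at the mediant (`markov_excess_bounds`).
Cutting the interval at the mediant splits the excess into the gap there and the two excesses of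
the halves. Nonnegativity therefore bounds the sum of the gaps inside the interval by the excess;
conversely, after cutting down to intervals that contain only rationals of denominator at least
`N`, what is left is at most a constant times a tail of the convergent sum of gaps. So the excess
is the sum of the gaps inside the interval (`FareyTree.excess_eq_tsum`).

This says that the series in the theorem, called `jumpSeries` below, has the same increments as `μ`
over Farey neighbours, so the two agree at all rationals. By dominated convergence `jumpSeries` is
continuous at irrational points, which gives the limits defining `μ` there, and its one-sided
limits are the sums over `r < x` and `r ≤ x`, which gives the saltus function.
-/

/-! ### Pairs of neighbouring Markov fractions -/

/-- The relation between the labels `p₁/q₁ < p₂/q₂` of two Farey neighbours. Each fraction `p/q` is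
the real part of a point `(p + i)/q` of the modular orbit of `i`, recorded by an integer `r` with
`q r = p² + 1`; with `k = p₂ q₁ - p₁ q₂` the equation for `3 k` is equivalent to the Markov equation
`q₁² + q₂² + k² = 3 q₁ q₂ k`, and the last inequality says that `k` is the smaller one of its two
solutions. -/
def IsMarkovPair (m n : ℚ) : Prop :=
  ∃ r s : ℤ, m.den * r = m.num ^ 2 + 1 ∧ n.den * s = n.num ^ 2 + 1 ∧
    m.den * s + n.den * r - 2 * m.num * n.num = 3 * (n.num * m.den - m.num * n.den) ∧
    0 < n.num * m.den - m.num * n.den ∧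
    2 * (n.num * m.den - m.num * n.den) ≤ 3 * (m.den * n.den : ℤ)

theorem isMarkovPair_zero_half : IsMarkovPair 0 (1 / 2) := by
  have h1 : (1 / 2 : ℚ).num = 1 := by norm_num
  have h2 : (1 / 2 : ℚ).den = 2 := by norm_num
  refine ⟨1, 1, ?_⟩
  rw [h1, h2]
  norm_num

theorem IsMarkovPair.markov_eq {m n : ℚ} (h : IsMarkovPair m n) :
    (m.den : ℤ) ^ 2 + n.den ^ 2 + (n.num * m.den - m.num * n.den) ^ 2 =
      3 * m.den * n.den * (n.num * m.den - m.num * n.den) := by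
  obtain ⟨r, s, h1, h2, h3, -, -⟩ := h
  linear_combination (m.den * n.den : ℤ) * h3 - (m.den : ℤ) ^ 2 * h2 - (n.den : ℤ) ^ 2 * h1

/-- The numerator, the denominator and the companion `r` of the Springborn mediant are integral
polynomials in the data of the two neighbours. -/
theorem IsMarkovPair.mediant_aux {m n : ℚ} {r s : ℤ} (h1 : m.den * r = m.num ^ 2 + 1)
    (h2 : n.den * s = n.num ^ 2 + 1)
    (h3 : m.den * s + n.den * r - 2 * m.num * n.num = 3 * (n.num * m.den - m.num * n.den))
    (h4 : 0 < n.num * m.den - m.num * n.den)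
    (h5 : 2 * (n.num * m.den - m.num * n.den) ≤ 3 * (m.den * n.den : ℤ)) :
    (springbornMediant m n).num = 3 * m.num * n.den + n.den * r - m.num * n.num ∧
    ((springbornMediant m n).den : ℤ) =
      3 * m.den * n.den - (n.num * m.den - m.num * n.den) ∧
    ((springbornMediant m n).den : ℤ) * (3 * m.num * n.num + n.num * r - m.num * s) =
      (springbornMediant m n).num ^ 2 + 1 := by
  have hq1 : (0 : ℤ) < m.den := by exact_mod_cast m.pos
  have hq2 : (0 : ℤ) < n.den := by exact_mod_cast n.pos
  have hM := IsMarkovPair.markov_eq ⟨r, s, h1, h2, h3, h4, h5⟩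
  have hsm : springbornMediant m n = ((m.num * m.den + n.num * n.den : ℤ) : ℚ) /
      (((m.den : ℤ) ^ 2 + (n.den : ℤ) ^ 2 : ℤ) : ℚ) := by
    unfold springbornMediant; push_cast; rfl
  generalize springbornMediant m n = z at *
  generalize (m.den : ℤ) = q₁ at *
  generalize (n.den : ℤ) = q₂ at *
  generalize m.num = p₁ at *
  generalize n.num = p₂ at *
  obtain ⟨q₃, hq₃⟩ : ∃ q₃, q₃ = 3 * q₁ * q₂ - (p₂ * q₁ - p₁ * q₂) := ⟨_, rfl⟩
  obtain ⟨p₃, hp₃⟩ : ∃ p₃, p₃ = 3 * p₁ * q₂ + q₂ * r - p₁ * p₂ := ⟨_, rfl⟩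
  obtain ⟨r₃, hr₃⟩ : ∃ r₃, r₃ = 3 * p₁ * p₂ + p₂ * r - p₁ * s := ⟨_, rfl⟩
  rw [← hq₃, ← hp₃, ← hr₃]
  have e1 : p₃ * q₁ - p₁ * q₃ = q₂ := by subst hq₃ hp₃; linear_combination q₂ * h1
  have e2 : p₂ * q₃ - p₃ * q₂ = q₁ := by
    subst hq₃ hp₃; linear_combination q₁ * h2 - q₂ * h3
  have e3 : p₃ * (p₂ * q₁ - p₁ * q₂) = p₁ * q₁ + p₂ * q₂ := by
    linear_combination p₂ * e1 + p₁ * e2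
  have e4 : q₃ * (p₂ * q₁ - p₁ * q₂) = q₁ ^ 2 + q₂ ^ 2 := by
    linear_combination q₂ * e1 + q₁ * e2
  have e5 : q₁ * r₃ + q₃ * r - 2 * p₁ * p₃ = 3 * q₂ := by
    subst hq₃ hp₃ hr₃; linear_combination -p₁ * h3 + 3 * q₂ * h1
  have hpos : 0 < q₃ := by nlinarith [mul_pos hq1 hq2]
  have e6 : q₃ * r₃ = p₃ ^ 2 + 1 := by
    have : q₁ ^ 2 * (q₃ * r₃) = q₁ ^ 2 * (p₃ ^ 2 + 1) := by
      linear_combination q₁ * q₃ * e5 - q₃ ^ 2 * h1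
        - (p₃ * q₁ - p₁ * q₃ + q₂) * e1 - q₃ * hq₃ + e4
    exact mul_left_cancel₀ (by positivity) this
  have hco : Nat.Coprime p₃.natAbs q₃.natAbs := by
    rw [← Int.isCoprime_iff_nat_coprime]
    exact ⟨-p₃, r₃, by linear_combination e6⟩
  have hz : z = (p₃ : ℚ) / q₃ := by
    rw [hsm, div_eq_div_iff]
    · have : (p₁ * q₁ + p₂ * q₂) * q₃ = p₃ * (q₁ ^ 2 + q₂ ^ 2) := by
        rw [← e3, ← e4]; ring
      exact_mod_cast this
    · have : q₁ ^ 2 + q₂ ^ 2 ≠ 0 := by positivity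
      exact_mod_cast this
    · exact_mod_cast hpos.ne'
  have n1 : z.num = p₃ := by rw [hz]; exact Rat.num_div_eq_of_coprime hpos hco
  have n2 : (z.den : ℤ) = q₃ := by rw [hz]; exact Rat.den_div_eq_of_coprime hpos hco
  exact ⟨n1, n2, by rw [n1, n2, e6]⟩

theorem IsMarkovPair.den_mediant {m n : ℚ} (h : IsMarkovPair m n) :
    ((springbornMediant m n).den : ℤ) =
      3 * m.den * n.den - (n.num * m.den - m.num * n.den) := by
  obtain ⟨r, s, h1, h2, h3, h4, h5⟩ := h
  exact (mediant_aux h1 h2 h3 h4 h5).2.1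

theorem IsMarkovPair.left {m n : ℚ} (h : IsMarkovPair m n) :
    IsMarkovPair m (springbornMediant m n) := by
  obtain ⟨r, s, h1, h2, h3, h4, h5⟩ := h
  obtain ⟨n1, n2, n3⟩ := mediant_aux h1 h2 h3 h4 h5
  have hq1 : (1 : ℤ) ≤ m.den := by exact_mod_cast m.pos
  have hq2 : (0 : ℤ) < n.den := by exact_mod_cast n.pos
  have hk : (springbornMediant m n).num * m.den - m.num * (springbornMediant m n).den =
      (n.den : ℤ) := by
    rw [n1, n2]; linear_combination (n.den : ℤ) * h1
  refine ⟨r, _, h1, n3, ?_, ?_, ?_⟩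
  · rw [hk, n1, n2]
    linear_combination -m.num * h3 + 3 * (n.den : ℤ) * h1
  · rwa [hk]
  · rw [hk, n2]
    have : (n.den : ℤ) ≤ m.den * n.den := le_mul_of_one_le_left hq2.le hq1
    nlinarith

theorem IsMarkovPair.right {m n : ℚ} (h : IsMarkovPair m n) :
    IsMarkovPair (springbornMediant m n) n := by
  obtain ⟨r, s, h1, h2, h3, h4, h5⟩ := h
  obtain ⟨n1, n2, n3⟩ := mediant_aux h1 h2 h3 h4 h5
  have hq1 : (0 : ℤ) < m.den := by exact_mod_cast m.pos
  have hq2 : (1 : ℤ) ≤ n.den := by exact_mod_cast n.pos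
  have hk : n.num * (springbornMediant m n).den - (springbornMediant m n).num * n.den =
      (m.den : ℤ) := by
    rw [n1, n2]; linear_combination (m.den : ℤ) * h2 - (n.den : ℤ) * h3
  refine ⟨_, s, n3, h2, ?_, ?_, ?_⟩
  · rw [hk, n1, n2]
    linear_combination -n.num * h3 + 3 * (m.den : ℤ) * h2
  · rwa [hk]
  · rw [hk, n2]
    have : (m.den : ℤ) ≤ m.den * n.den := le_mul_of_one_le_right hq1.le hq2
    nlinarith

/-! ### The Farey tree -/

/-- The pairs of Farey neighbours obtained from `0, 1` by repeatedly inserting mediants. -/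
inductive FareyTree : ℚ → ℚ → Prop
  | root : FareyTree 0 1
  | left {x y : ℚ} : FareyTree x y → FareyTree x (fareyMediant x y)
  | right {x y : ℚ} : FareyTree x y → FareyTree (fareyMediant x y) y

namespace FareyTree

variable {x y : ℚ}

theorem isFareyPair (h : FareyTree x y) : IsFareyPair x y := by
  induction h with
  | root => simp [IsFareyPair]
  | left _ ih => exact ih.left
  | right _ ih => exact ih.right

theorem lt (h : FareyTree x y) : x < y := h.isFareyPair.lt

theorem lt_mediant (h : FareyTree x y) : x < fareyMediant x y := h.left.lt

theorem mediant_lt (h : FareyTree x y) : fareyMediant x y < y := h.right.lt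

theorem nonneg_and_le_one (h : FareyTree x y) : 0 ≤ x ∧ y ≤ 1 := by
  induction h with
  | root => simp
  | left h ih => exact ⟨ih.1, h.mediant_lt.le.trans ih.2⟩
  | right h ih => exact ⟨ih.1.trans h.lt_mediant.le, ih.2⟩

theorem left_mem (h : FareyTree x y) : x ∈ Icc (0 : ℚ) 1 :=
  ⟨h.nonneg_and_le_one.1, h.lt.le.trans h.nonneg_and_le_one.2⟩

theorem right_mem (h : FareyTree x y) : y ∈ Icc (0 : ℚ) 1 :=
  ⟨h.nonneg_and_le_one.1.trans h.lt.le, h.nonneg_and_le_one.2⟩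

theorem mediant_mem (h : FareyTree x y) : fareyMediant x y ∈ Icc (0 : ℚ) 1 := h.left.right_mem

theorem springbornRat_mediant (h : FareyTree x y) :
    springbornRat (fareyMediant x y) = springbornMediant (springbornRat x) (springbornRat y) :=
  springbornRat_fareyMediant h.nonneg_and_le_one.1 h.nonneg_and_le_one.2 h.isFareyPair

theorem isMarkovPair (h : FareyTree x y) :
    IsMarkovPair (springbornRat x) (springbornRat y) := by
  induction h with
  | root => rw [springbornRat_zero, springbornRat_one]; exact isMarkovPair_zero_half
  | left h ih => rw [h.springbornRat_mediant]; exact ih.left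
  | right h ih => rw [h.springbornRat_mediant]; exact ih.right

/-- Induction from the leaves: a property that holds for all pairs whose denominators have sum at
least `N` and that passes from the two halves of an interval to the whole holds for all pairs. -/
theorem induction_leaves {P : ℚ → ℚ → Prop} (N : ℕ)
    (leaf : ∀ {x y}, FareyTree x y → N ≤ x.den + y.den → P x y)
    (split : ∀ {x y}, FareyTree x y → P x (fareyMediant x y) → P (fareyMediant x y) y → P x y)
    (h : FareyTree x y) : P x y := by
  suffices H : ∀ d : ℕ, ∀ {x y}, FareyTree x y → N ≤ d + (x.den + y.den) → P x y from
    H N h (by omega)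
  intro d
  induction d with
  | zero => intro x y h hN; exact leaf h (by omega)
  | succ d ih =>
    intro x y h hN
    have hm := h.isFareyPair.mediant.2
    have := x.pos
    have := y.pos
    exact split h (ih h.left (by omega)) (ih h.right (by omega))

/-- Every rational number of an interval of the tree is an end of some interval of the tree. -/
theorem exists_right_or_left {r : ℚ} (h : FareyTree x y) :
    x ≤ r → r ≤ y → ∃ a b, FareyTree a b ∧ (r = a ∨ r = b) := by
  refine h.induction_leaves (P := fun x y => x ≤ r → r ≤ y → ∃ a b, FareyTree a b ∧ (r = a ∨ r = b))
    (r.den + 1) ?_ ?_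
  · intro x y h hN hx hy
    rcases hx.eq_or_lt with rfl | hx
    · exact ⟨_, _, h, Or.inl rfl⟩
    rcases hy.eq_or_lt with rfl | hy
    · exact ⟨_, _, h, Or.inr rfl⟩
    have := h.isFareyPair.den_le hx hy
    omega
  · intro x y h h1 h2 hx hy
    rcases le_total r (fareyMediant x y) with hr | hr
    · exact h1 hx hr
    · exact h2 hr hy

end FareyTree

/-! ### Gap lengths -/

/-- `√(9q² - 4)/q`, the complement of the gap length to `3`, is the positive square root of
`9 - 4/q²`. -/
theorem exists_gapLength_eq {q : ℕ} (hq : 0 < q) :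
    ∃ A : ℝ, gapLength q = 3 - A ∧ 2 < A ∧ A < 3 ∧ A ^ 2 = 9 - 4 * (1 / (q : ℝ) ^ 2) := by
  have hq' : (1 : ℝ) ≤ q := by exact_mod_cast hq
  have h0 : (0 : ℝ) < q := by linarith
  have hsq : (√(9 * (q : ℝ) ^ 2 - 4) / q) ^ 2 = 9 - 4 * (1 / (q : ℝ) ^ 2) := by
    rw [div_pow, Real.sq_sqrt (by nlinarith)]
    field_simp
  have hnn : 0 ≤ √(9 * (q : ℝ) ^ 2 - 4) / q := by positivity
  have h1 : 1 / (q : ℝ) ^ 2 ≤ 1 := by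
    rw [div_le_one (by positivity)]; nlinarith
  have h2 : 0 < 1 / (q : ℝ) ^ 2 := by positivity
  refine ⟨_, rfl, ?_, ?_, hsq⟩ <;> nlinarith

theorem gapLength_pos {q : ℕ} (hq : 0 < q) : 0 < gapLength q := by
  obtain ⟨A, h, -, hA, -⟩ := exists_gapLength_eq hq
  linarith

theorem gapLength_ge {q : ℕ} (hq : 0 < q) : 2 / 3 * (1 / (q : ℝ) ^ 2) ≤ gapLength q := by
  obtain ⟨A, h, h2, hA, hsq⟩ := exists_gapLength_eq hq
  rw [h]
  nlinarith

/-- The length of the interval between two Markov fractions exceeds the half gaps at its ends by an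
amount that is nonnegative and at most a constant multiple of the gap at the next Markov
fraction. -/
theorem markov_excess_bounds {q₁ q₂ q₃ : ℕ} {k : ℝ} (h1 : 0 < q₁) (h2 : 0 < q₂) (h3 : 0 < q₃)
    (hM : (q₁ : ℝ) ^ 2 + q₂ ^ 2 + k ^ 2 = 3 * q₁ * q₂ * k) (hk : 0 < k)
    (hk2 : 2 * k ≤ 3 * (q₁ * q₂)) (hq3 : (q₃ : ℝ) = 3 * q₁ * q₂ - k) :
    0 ≤ k / (q₁ * q₂) - gapLength q₁ / 2 - gapLength q₂ / 2 ∧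
      k / (q₁ * q₂) - gapLength q₁ / 2 - gapLength q₂ / 2 ≤ 8 * gapLength q₃ := by
  obtain ⟨A, eA, hA2, hA3, hA⟩ := exists_gapLength_eq h1
  obtain ⟨B, eB, hB2, hB3, hB⟩ := exists_gapLength_eq h2
  have hl := gapLength_ge h3
  have h1' : (0 : ℝ) < q₁ := by exact_mod_cast h1
  have h2' : (0 : ℝ) < q₂ := by exact_mod_cast h2
  have h3' : (0 : ℝ) < q₃ := by exact_mod_cast h3
  obtain ⟨E, hE⟩ : ∃ E, E = 3 - 2 * (k / (q₁ * q₂)) := ⟨_, rfl⟩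
  have hE0 : 0 ≤ E := by
    have : k / ((q₁ : ℝ) * q₂) ≤ 3 / 2 := by
      rw [div_le_iff₀ (by positivity)]; linarith
    linarith
  have hEsq : E ^ 2 = 9 - 4 * (1 / (q₁ : ℝ) ^ 2) - 4 * (1 / (q₂ : ℝ) ^ 2) := by
    rw [hE]; field_simp; linear_combination 4 * hM
  have hc : 1 / (q₁ : ℝ) ^ 2 * (1 / (q₂ : ℝ) ^ 2) ≤ 9 * (1 / (q₃ : ℝ) ^ 2) := by
    have : (q₃ : ℝ) ^ 2 ≤ (3 * (q₁ * q₂)) ^ 2 := by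
      apply pow_le_pow_left₀ h3'.le; linarith
    rw [div_mul_div_comm, mul_one_div, div_le_div_iff₀ (by positivity) (by positivity)]
    nlinarith
  rw [eA, eB]
  have ha : 0 < 1 / (q₁ : ℝ) ^ 2 := by positivity
  have hb : 0 < 1 / (q₂ : ℝ) ^ 2 := by positivity
  generalize 1 / (q₁ : ℝ) ^ 2 = a at *
  generalize 1 / (q₂ : ℝ) ^ 2 = b at *
  generalize 1 / (q₃ : ℝ) ^ 2 = c at *
  have hkE : k / (q₁ * q₂ : ℝ) = (3 - E) / 2 := by rw [hE]; ring
  rw [hkE]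
  -- Rationalizing the excess twice turns it into a multiple of `a b`.
  have key : (A + B - 3 - E) * ((A + B + 3 + E) * (A * B + 3 * E)) = 32 * (a * b) := by
    have e1 : (A + B - 3 - E) * (A + B + 3 + E) = 2 * (A * B - 3 * E) := by
      linear_combination hA + hB - hEsq
    have e2 : (A * B - 3 * E) * (A * B + 3 * E) = 16 * (a * b) := by
      linear_combination (9 - 4 * b) * hA + A ^ 2 * hB - 9 * hEsq
    linear_combination (A * B + 3 * E) * e1 + 2 * e2
  have hAB : 4 ≤ A * B := by nlinarith
  have hD : 28 ≤ (A + B + 3 + E) * (A * B + 3 * E) :=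
    calc (28 : ℝ) = 7 * 4 := by norm_num
      _ ≤ _ := by gcongr <;> linarith
  have hX : 0 ≤ A + B - 3 - E :=
    nonneg_of_mul_nonneg_left (by rw [key]; positivity) (by linarith)
  constructor
  · linarith
  · have : 28 * (A + B - 3 - E) ≤ 32 * (a * b) := by
      rw [← key, mul_comm]
      exact mul_le_mul_of_nonneg_left hD hX
    linarith [mul_pos ha hb]

/-! ### The excess of an interval and the sum of the gaps inside it -/

theorem markovNumber_pos (x : ℚ) : 0 < markovNumber x := (springbornRat x).pos

/-- The length of the interval from `μ(x)` to `μ(y)` minus the half gaps at its ends. -/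
noncomputable def excess (x y : ℚ) : ℝ :=
  springbornRat y - springbornRat x - gapLength (markovNumber x) / 2 -
    gapLength (markovNumber y) / 2

theorem excess_split (x y z : ℚ) :
    excess x z = excess x y + gapLength (markovNumber y) + excess y z := by
  unfold excess; ring

theorem FareyTree.excess_bounds {x y : ℚ} (h : FareyTree x y) :
    0 ≤ excess x y ∧ excess x y ≤ 8 * gapLength (markovNumber (fareyMediant x y)) := by
  have hp := h.isMarkovPair
  have hM := hp.markov_eq
  have hd := hp.den_mediant
  obtain ⟨-, -, -, -, -, hk, hk2⟩ := hp
  rw [← h.springbornRat_mediant] at hd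
  have hb := markov_excess_bounds (markovNumber_pos x) (markovNumber_pos y)
    (markovNumber_pos (fareyMediant x y))
    (k := (springbornRat y).num * (springbornRat x).den -
      (springbornRat x).num * (springbornRat y).den)
    (by unfold markovNumber; exact_mod_cast hM) (by exact_mod_cast hk)
    (by unfold markovNumber; exact_mod_cast hk2) (by unfold markovNumber; exact_mod_cast hd)
  have e : ((springbornRat y : ℝ) - springbornRat x) =
      ((springbornRat y).num * (springbornRat x).den -
      (springbornRat x).num * (springbornRat y).den : ℝ) /
        (markovNumber x * markovNumber y : ℝ) := by
    have hx : ((springbornRat x).den : ℝ) ≠ 0 := by exact_mod_cast (springbornRat x).den_nz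
    have hy : ((springbornRat y).den : ℝ) ≠ 0 := by exact_mod_cast (springbornRat y).den_nz
    unfold markovNumber
    rw [Rat.cast_def, Rat.cast_def]
    field_simp
  rwa [← e] at hb

/-- The gap at the Markov fraction with index `r`. -/
noncomputable def gapWeight (r : Icc (0 : ℚ) 1) : ℝ := gapLength (markovNumber r)

theorem gapWeight_pos (r : Icc (0 : ℚ) 1) : 0 < gapWeight r := gapLength_pos (markovNumber_pos r)

theorem ite_Ioo_split {x m y : ℚ} (h1 : x < m) (h2 : m < y) (r : ℚ) (c : ℝ) :
    (if x < r ∧ r < y then c else 0) =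
      (if x < r ∧ r < m then c else 0) + (if r = m then c else 0) +
        (if m < r ∧ r < y then c else 0) := by
  grind

/-- Nonnegativity of the excess of the small intervals bounds the finite sums of gaps. -/
theorem FareyTree.sum_gapWeight_le {x y : ℚ} (h : FareyTree x y) (s : Finset (Icc (0 : ℚ) 1)) :
    ∑ r ∈ s, (if x < (r : ℚ) ∧ (r : ℚ) < y then gapWeight r else 0) ≤ excess x y := by
  refine h.induction_leaves
    (P := fun x y => ∑ r ∈ s, (if x < (r : ℚ) ∧ (r : ℚ) < y then gapWeight r else 0) ≤ excess x y)
    (s.sup (fun r => (r : ℚ).den) + 1) ?_ ?_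
  · intro x y h hN
    rw [Finset.sum_eq_zero]
    · exact h.excess_bounds.1
    · intro r hr
      have h1 : (r : ℚ).den ≤ s.sup (fun r => (r : ℚ).den) :=
        Finset.le_sup (f := fun r : Icc (0 : ℚ) 1 => (r : ℚ).den) hr
      refine if_neg fun ⟨h2, h3⟩ => ?_
      have := h.isFareyPair.den_le h2 h3
      omega
  · intro x y h h1 h2
    rw [excess_split x (fareyMediant x y) y]
    simp_rw [ite_Ioo_split h.lt_mediant h.mediant_lt, Finset.sum_add_distrib]
    have h3 : ∑ r ∈ s, (if (r : ℚ) = fareyMediant x y then gapWeight r else 0) ≤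
        gapLength (markovNumber (fareyMediant x y)) := by
      have e : ∀ r : Icc (0 : ℚ) 1, (if (r : ℚ) = fareyMediant x y then gapWeight r else 0) =
          if r = ⟨fareyMediant x y, h.mediant_mem⟩ then gapWeight r else 0 := fun r => by
        simp only [Subtype.ext_iff]
      simp_rw [e, Finset.sum_ite_eq']
      split_ifs
      · exact le_rfl
      · exact (gapWeight_pos ⟨fareyMediant x y, h.mediant_mem⟩).le
    linarith

theorem hasSum_ite_coe_eq {x : ℚ} (hx : x ∈ Icc (0 : ℚ) 1) (f : Icc (0 : ℚ) 1 → ℝ) :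
    HasSum (fun r : Icc (0 : ℚ) 1 => if (r : ℚ) = x then f r else 0) (f ⟨x, hx⟩) := by
  convert! hasSum_ite_eq (⟨x, hx⟩ : Icc (0 : ℚ) 1) (f ⟨x, hx⟩) using 2 with r
  by_cases h : r = ⟨x, hx⟩
  · subst h; simp
  · rw [if_neg h, if_neg (fun h' => h (Subtype.ext h'))]

theorem summable_gapWeight : Summable gapWeight := by
  have h : Summable fun r : Icc (0 : ℚ) 1 =>
      if 0 < (r : ℚ) ∧ (r : ℚ) < 1 then gapWeight r else 0 := by
    refine summable_of_sum_le (fun r => ?_) (fun s => FareyTree.root.sum_gapWeight_le s)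
    dsimp only
    split_ifs
    · exact (gapWeight_pos r).le
    · exact le_rfl
  refine ((h.add (hasSum_ite_coe_eq (x := 0) (by simp) gapWeight).summable).add
    (hasSum_ite_coe_eq (x := 1) (by simp) gapWeight).summable).congr fun r => ?_
  obtain ⟨r, h0, h1⟩ := r
  rcases h0.eq_or_lt with rfl | h0
  · simp
  rcases h1.eq_or_lt with rfl | h1
  · simp
  simp [h0, h1, h0.ne', h1.ne]

theorem summable_gapWeight_mul {c : Icc (0 : ℚ) 1 → ℝ} {C : ℝ} (hc : ∀ r, |c r| ≤ C) :
    Summable fun r => gapWeight r * c r := by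
  refine (summable_gapWeight.mul_right C).of_norm_bounded fun r => ?_
  rw [Real.norm_eq_abs, abs_mul, abs_of_pos (gapWeight_pos r)]
  exact mul_le_mul_of_nonneg_left (hc r) (gapWeight_pos r).le

/-- Dominated convergence for the gap series with bounded coefficients. -/
theorem tendsto_tsum_gapWeight_mul {α : Type*} {F : Filter α} {c : α → Icc (0 : ℚ) 1 → ℝ}
    {d : Icc (0 : ℚ) 1 → ℝ} {C : ℝ} (hc : ∀ t r, |c t r| ≤ C)
    (h : ∀ r, Tendsto (fun t => c t r) F (𝓝 (d r))) :
    Tendsto (fun t => ∑' r, gapWeight r * c t r) F (𝓝 (∑' r, gapWeight r * d r)) := by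
  refine tendsto_tsum_of_dominated_convergence (summable_gapWeight.mul_right C)
    (fun r => (h r).const_mul _) (Eventually.of_forall fun t r => ?_)
  rw [Real.norm_eq_abs, abs_mul, abs_of_pos (gapWeight_pos r)]
  exact mul_le_mul_of_nonneg_left (hc t r) (gapWeight_pos r).le

/-- The weight `8` on the indices of denominator at least `N` absorbs the excess of the intervals
that contain only such indices; by additivity the estimate passes to all intervals. -/
theorem FareyTree.excess_le_tsum {x y : ℚ} (h : FareyTree x y) (N : ℕ) :
    excess x y ≤ ∑' r : Icc (0 : ℚ) 1, gapWeight r *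
      (if x < (r : ℚ) ∧ (r : ℚ) < y then (if (r : ℚ).den < N then 1 else 8) else 0) := by
  have hs : ∀ x y : ℚ, Summable fun r : Icc (0 : ℚ) 1 => gapWeight r *
      (if x < (r : ℚ) ∧ (r : ℚ) < y then (if (r : ℚ).den < N then (1 : ℝ) else 8) else 0) :=
    fun x y => summable_gapWeight_mul (C := 8) fun r => by split_ifs <;> norm_num
  refine h.induction_leaves (P := fun x y => excess x y ≤ ∑' r : Icc (0 : ℚ) 1, gapWeight r *
      (if x < (r : ℚ) ∧ (r : ℚ) < y then (if (r : ℚ).den < N then 1 else 8) else 0)) N ?_ ?_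
  · intro x y h hN
    have hden : ¬ (fareyMediant x y).den < N := by rw [h.isFareyPair.mediant.2]; omega
    refine h.excess_bounds.2.trans ?_
    refine le_trans ?_ ((hs x y).le_tsum ⟨fareyMediant x y, h.mediant_mem⟩ fun r _ =>
      mul_nonneg (gapWeight_pos r).le (by split_ifs <;> norm_num))
    simp [h.lt_mediant, h.mediant_lt, hden, gapWeight, mul_comm]
  · intro x y h h1 h2
    rw [excess_split x (fareyMediant x y) y]
    have hm := hasSum_ite_coe_eq h.mediant_mem
      fun r => gapWeight r * (if (r : ℚ).den < N then (1 : ℝ) else 8)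
    have e := ((hs x (fareyMediant x y)).hasSum.add hm).add (hs (fareyMediant x y) y).hasSum
    have h3 : gapLength (markovNumber (fareyMediant x y)) ≤
        gapWeight ⟨fareyMediant x y, h.mediant_mem⟩ *
          (if (fareyMediant x y).den < N then (1 : ℝ) else 8) := by
      have := gapWeight_pos ⟨fareyMediant x y, h.mediant_mem⟩
      change gapWeight ⟨fareyMediant x y, h.mediant_mem⟩ ≤ _
      split_ifs <;> linarith
    refine le_trans ?_ (e.tsum_eq.symm.trans (tsum_congr fun r => ?_)).le
    · linarith
    · rw [ite_Ioo_split h.lt_mediant h.mediant_lt, mul_add, mul_add]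
      simp only [mul_ite, mul_zero]

/-- The excess of an interval of the tree is the sum of the gaps inside it. -/
theorem FareyTree.excess_eq_tsum {x y : ℚ} (h : FareyTree x y) :
    excess x y = ∑' r : Icc (0 : ℚ) 1, gapWeight r *
      (if x < (r : ℚ) ∧ (r : ℚ) < y then 1 else 0) := by
  apply le_antisymm
  · refine ge_of_tendsto' (tendsto_tsum_gapWeight_mul (F := atTop) (C := 8) (fun N r => ?_) fun r => ?_)
      h.excess_le_tsum
    · split_ifs <;> norm_num
    · refine tendsto_const_nhds.congr' ?_
      filter_upwards [eventually_gt_atTop (r : ℚ).den] with N hN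
      rw [if_pos hN]
  · refine Real.tsum_le_of_sum_le (fun r => ?_) fun s => ?_
    · have := gapWeight_pos r
      dsimp only
      positivity
    · simpa only [mul_ite, mul_one, mul_zero] using h.sum_gapWeight_le s

/-! ### The jump function -/

theorem heaviside_of_neg {x : ℝ} (h : x < 0) : heaviside x = 0 := if_pos h

theorem heaviside_zero : heaviside 0 = 1 / 2 := by simp [heaviside]

theorem heaviside_of_pos {x : ℝ} (h : 0 < x) : heaviside x = 1 := by
  simp [heaviside, h.not_gt, h.ne']

theorem abs_heaviside_le (x : ℝ) : |heaviside x| ≤ 1 := by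
  unfold heaviside; split_ifs <;> norm_num [abs_le]

theorem monotone_heaviside : Monotone heaviside := by
  intro x y h
  unfold heaviside
  split_ifs <;> first | (exfalso; grind) | norm_num

/-- The right-hand side of the series representation of Springborn's function. -/
noncomputable def jumpSeries (x : ℝ) : ℝ :=
  -(1 / 2) * gapLength 1 + ∑' r : Icc (0 : ℚ) 1, gapWeight r * heaviside (x - ((r : ℚ) : ℝ))

theorem summable_jumpSeries (x : ℝ) :
    Summable fun r : Icc (0 : ℚ) 1 => gapWeight r * heaviside (x - ((r : ℚ) : ℝ)) :=
  summable_gapWeight_mul fun _ => abs_heaviside_le _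

theorem markovNumber_zero : markovNumber 0 = 1 := by simp [markovNumber, springbornRat_zero]

theorem jumpSeries_zero : jumpSeries 0 = 0 := by
  have h := hasSum_ite_coe_eq (x := 0) (by simp) fun r => gapWeight r * (1 / 2)
  have e : (∑' r : Icc (0 : ℚ) 1, gapWeight r * heaviside (0 - ((r : ℚ) : ℝ))) =
      gapWeight ⟨0, by simp⟩ * (1 / 2) := by
    refine Eq.trans (tsum_congr fun r => ?_) h.tsum_eq
    split_ifs with hr
    · rw [hr, Rat.cast_zero, sub_zero, heaviside_zero]
    · have : (0 : ℝ) < (r : ℚ) := by exact_mod_cast lt_of_le_of_ne r.2.1 (Ne.symm hr)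
      rw [heaviside_of_neg (by linarith), mul_zero]
  rw [jumpSeries, e, gapWeight, markovNumber_zero]
  ring

theorem FareyTree.jumpSeries_sub {x y : ℚ} (h : FareyTree x y) :
    jumpSeries y - jumpSeries x = springbornRat y - springbornRat x := by
  have e := h.excess_eq_tsum
  have hs : Summable fun r : Icc (0 : ℚ) 1 => gapWeight r *
      (if x < (r : ℚ) ∧ (r : ℚ) < y then (1 : ℝ) else 0) :=
    summable_gapWeight_mul (C := 1) fun r => by split_ifs <;> norm_num
  have h3 := ((hs.hasSum.add (hasSum_ite_coe_eq h.left_mem fun r => gapWeight r / 2)).add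
    (hasSum_ite_coe_eq h.right_mem fun r => gapWeight r / 2)).tsum_eq
  have h4 : jumpSeries y - jumpSeries x = ∑' r : Icc (0 : ℚ) 1,
      (gapWeight r * heaviside ((y : ℝ) - ((r : ℚ) : ℝ)) -
        gapWeight r * heaviside ((x : ℝ) - ((r : ℚ) : ℝ))) := by
    rw [(summable_jumpSeries y).tsum_sub (summable_jumpSeries x), jumpSeries, jumpSeries]
    ring
  rw [← e] at h3
  have h5 : (springbornRat y : ℝ) - springbornRat x = excess x y +
      gapWeight ⟨x, h.left_mem⟩ / 2 + gapWeight ⟨y, h.right_mem⟩ / 2 := by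
    unfold excess gapWeight; ring
  rw [h4, h5, ← h3]
  refine tsum_congr fun r => ?_
  have hxy := h.lt
  have cast : ∀ z : ℚ, heaviside ((z : ℝ) - ((r : ℚ) : ℝ)) =
      if z < r then 0 else if (r : ℚ) = z then 1 / 2 else 1 := fun z => by
    unfold heaviside
    simp only [sub_neg, sub_eq_zero, Rat.cast_lt, Rat.cast_inj, eq_comm (a := z)]
  rw [cast, cast]
  grind

/-- The jump function agrees with Springborn's function at rational points. -/
theorem jumpSeries_ratCast {r : ℚ} (hr : r ∈ Icc (0 : ℚ) 1) : jumpSeries r = springbornRat r := by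
  have H : ∀ {x y : ℚ}, FareyTree x y →
      jumpSeries x = springbornRat x ∧ jumpSeries y = springbornRat y := by
    intro x y h
    induction h with
    | root =>
      have h1 := FareyTree.root.jumpSeries_sub
      have h0 : jumpSeries ((0 : ℚ) : ℝ) = springbornRat 0 := by
        rw [springbornRat_zero, Rat.cast_zero, jumpSeries_zero]
      exact ⟨h0, by linarith⟩
    | left h ih => exact ⟨ih.1, by linarith [h.left.jumpSeries_sub]⟩
    | right h ih => exact ⟨by linarith [h.right.jumpSeries_sub], ih.2⟩
  obtain ⟨a, b, h, rfl | rfl⟩ := FareyTree.root.exists_right_or_left hr.1 hr.2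
  · exact (H h).1
  · exact (H h).2

theorem jumpSeries_lt {x y : ℝ} (hx : 0 ≤ x) (hy : y ≤ 1) (h : x < y) :
    jumpSeries x < jumpSeries y := by
  obtain ⟨r, h1, h2⟩ := exists_rat_btwn h
  have hr : r ∈ Icc (0 : ℚ) 1 := ⟨by exact_mod_cast (hx.trans_lt h1).le,
    by exact_mod_cast (h2.trans_le hy).le⟩
  unfold jumpSeries
  gcongr ?_ + ?_
  refine Summable.tsum_lt_tsum (i := ⟨r, hr⟩) (fun s => ?_) ?_ (summable_jumpSeries x)
    (summable_jumpSeries y)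
  · exact mul_le_mul_of_nonneg_left (monotone_heaviside (by linarith)) (gapWeight_pos s).le
  · rw [heaviside_of_neg (by simpa using h1), heaviside_of_pos (by simpa using h2), mul_zero,
      mul_one]
    exact gapWeight_pos _

theorem tendsto_jumpSeries_of_irrational {x : ℝ} (hx : Irrational x) :
    Tendsto jumpSeries (𝓝 x) (𝓝 (jumpSeries x)) := by
  refine tendsto_const_nhds.add
    (tendsto_tsum_gapWeight_mul (fun _ _ => abs_heaviside_le _) fun r => ?_)
  rcases lt_or_gt_of_ne (hx.ne_rat (r : ℚ)) with h | h
  · rw [heaviside_of_neg (by linarith)]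
    refine tendsto_const_nhds.congr' ?_
    filter_upwards [eventually_lt_nhds h] with t ht
    rw [heaviside_of_neg (by linarith)]
  · rw [heaviside_of_pos (by linarith)]
    refine tendsto_const_nhds.congr' ?_
    filter_upwards [eventually_gt_nhds h] with t ht
    rw [heaviside_of_pos (by linarith)]

theorem tendsto_jumpSeries_left (x : ℝ) :
    Tendsto jumpSeries (𝓝[<] x) (𝓝 (-(1 / 2) * gapLength 1 +
      ∑' r : Icc (0 : ℚ) 1, gapWeight r * (if ((r : ℚ) : ℝ) < x then 1 else 0))) := by
  refine tendsto_const_nhds.add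
    (tendsto_tsum_gapWeight_mul (fun _ _ => abs_heaviside_le _) fun r => ?_)
  refine tendsto_const_nhds.congr' ?_
  split_ifs with h
  · filter_upwards [eventually_nhdsWithin_of_eventually_nhds (eventually_gt_nhds h)] with t ht
    rw [heaviside_of_pos (by linarith)]
  · filter_upwards [self_mem_nhdsWithin] with t ht
    rw [heaviside_of_neg (by rw [mem_Iio] at ht; linarith)]

theorem tendsto_jumpSeries_right (x : ℝ) :
    Tendsto jumpSeries (𝓝[>] x) (𝓝 (-(1 / 2) * gapLength 1 +
      ∑' r : Icc (0 : ℚ) 1, gapWeight r * (if ((r : ℚ) : ℝ) ≤ x then 1 else 0))) := by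
  refine tendsto_const_nhds.add
    (tendsto_tsum_gapWeight_mul (fun _ _ => abs_heaviside_le _) fun r => ?_)
  refine tendsto_const_nhds.congr' ?_
  split_ifs with h
  · filter_upwards [self_mem_nhdsWithin] with t ht
    rw [heaviside_of_pos (by rw [mem_Ioi] at ht; linarith)]
  · filter_upwards [eventually_nhdsWithin_of_eventually_nhds
      (eventually_lt_nhds (not_le.1 h))] with t ht
    rw [heaviside_of_neg (by linarith)]

/-! ### Springborn's function on the unit interval -/

theorem comap_ratCast_neBot {x : unitInterval} (hx : Irrational (x : ℝ)) :
    (comap (fun r : Icc (0 : ℚ) 1 => ((r : ℚ) : ℝ)) (𝓝 (x : ℝ))).NeBot := by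
  refine comap_neBot fun t ht => ?_
  have h0 : (0 : ℝ) < x := lt_of_le_of_ne x.2.1 (Ne.symm hx.ne_zero)
  have h1 : (x : ℝ) < 1 := lt_of_le_of_ne x.2.2 hx.ne_one
  obtain ⟨l, u, hx', hlu⟩ := mem_nhds_iff_exists_Ioo_subset.1
    (inter_mem ht (Ioo_mem_nhds h0 h1))
  obtain ⟨r, hr1, hr2⟩ := exists_rat_btwn hx'.1
  obtain ⟨ht', hr⟩ := hlu ⟨hr1, hr2.trans hx'.2⟩
  exact ⟨⟨r, by exact_mod_cast hr.1.le, by exact_mod_cast hr.2.le⟩, ht'⟩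

theorem tendsto_springbornRat {x : ℝ} (hx : Irrational x) :
    Tendsto (fun r : Icc (0 : ℚ) 1 => (springbornRat r : ℝ))
      (comap (fun r : Icc (0 : ℚ) 1 => ((r : ℚ) : ℝ)) (𝓝 x)) (𝓝 (jumpSeries x)) :=
  ((tendsto_jumpSeries_of_irrational hx).comp tendsto_comap).congr
    fun r => jumpSeries_ratCast r.2

theorem springborn_eq_jumpSeries (x : unitInterval) : springborn x = jumpSeries x := by
  by_cases h : ∃ r : ℚ, (r : ℝ) = x
  · obtain ⟨r, hr⟩ := h
    have hr' : r ∈ Icc (0 : ℚ) 1 :=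
      ⟨by exact_mod_cast hr ▸ x.2.1, by exact_mod_cast hr ▸ x.2.2⟩
    rw [springborn_ratCast ⟨r, hr'⟩ x hr, ← hr, jumpSeries_ratCast hr']
  · have hx : Irrational (x : ℝ) := fun ⟨r, hr⟩ => h ⟨r, hr⟩
    have := comap_ratCast_neBot hx
    rw [springborn, dif_neg h]
    exact (tendsto_springbornRat hx).limUnder_eq

theorem leftLim_springborn {x : unitInterval} (hx : 0 < x) :
    Function.leftLim springborn x = -(1 / 2) * gapLength 1 +
      ∑' r : Icc (0 : ℚ) 1, gapWeight r * (if ((r : ℚ) : ℝ) < x then 1 else 0) := by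
  have : (𝓝[<] x).NeBot := nhdsLT_neBot_of_exists_lt ⟨0, hx⟩
  apply leftLim_eq_of_tendsto
  rw [funext springborn_eq_jumpSeries]
  refine (tendsto_jumpSeries_left x).comp (tendsto_nhdsWithin_of_tendsto_nhds_of_eventually_within _
    (continuous_subtype_val.continuousAt.mono_left nhdsWithin_le_nhds) ?_)
  filter_upwards [self_mem_nhdsWithin] with t ht using ht

theorem rightLim_springborn {x : unitInterval} (hx : x < 1) :
    Function.rightLim springborn x = -(1 / 2) * gapLength 1 +
      ∑' r : Icc (0 : ℚ) 1, gapWeight r * (if ((r : ℚ) : ℝ) ≤ x then 1 else 0) := by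
  have : (𝓝[>] x).NeBot := nhdsGT_neBot_of_exists_gt ⟨1, hx⟩
  apply rightLim_eq_of_tendsto
  rw [funext springborn_eq_jumpSeries]
  refine (tendsto_jumpSeries_right x).comp
    (tendsto_nhdsWithin_of_tendsto_nhds_of_eventually_within _
    (continuous_subtype_val.continuousAt.mono_left nhdsWithin_le_nhds) ?_)
  filter_upwards [self_mem_nhdsWithin] with t ht using ht

theorem springborn_zero : springborn 0 = 0 := by
  rw [springborn_eq_jumpSeries]; exact jumpSeries_zero

theorem leftLim_springborn_zero : Function.leftLim springborn 0 = 0 := by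
  rw [leftLim_eq_of_isBot fun x => x.2.1, springborn_zero]

theorem summable_gapWeight_ite (p : Icc (0 : ℚ) 1 → Prop) [DecidablePred p] :
    Summable fun r => gapWeight r * (if p r then 1 else 0) :=
  summable_gapWeight_mul (C := 1) fun r => by split_ifs <;> norm_num

/-- The jump of `springborn` at `y` is the gap with index `y`, if there is one. Only half of it is
seen at `0`, where the left limit is the value by convention. -/
theorem springborn_jump {y : unitInterval} (hy : y < 1) :
    Function.rightLim springborn y - Function.leftLim springborn y =
      (∑' r : Icc (0 : ℚ) 1, gapWeight r * (if ((r : ℚ) : ℝ) = y then 1 else 0)) -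
        if y = 0 then gapLength 1 / 2 else 0 := by
  rw [rightLim_springborn hy]
  split_ifs with h
  · subst h
    rw [leftLim_springborn_zero, sub_zero]
    have : ∀ r : Icc (0 : ℚ) 1, ((r : ℚ) : ℝ) ≤ ((0 : unitInterval) : ℝ) ↔
        ((r : ℚ) : ℝ) = ((0 : unitInterval) : ℝ) := fun r =>
      ⟨fun h => le_antisymm h (by simpa using r.2.1), fun h => h.le⟩
    simp_rw [this]
    ring
  · rw [leftLim_springborn (unitInterval.pos_iff_ne_zero.2 h), add_sub_add_left_eq_sub, sub_zero,
      ← (summable_gapWeight_ite _).tsum_sub (summable_gapWeight_ite _)]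
    refine tsum_congr fun r => ?_
    grind

/-- The inclusion of the rational points of `[0, 1]`. -/
noncomputable def ratToUnitInterval (r : Icc (0 : ℚ) 1) : unitInterval :=
  ⟨((r : ℚ) : ℝ), by exact_mod_cast r.2.1, by exact_mod_cast r.2.2⟩

theorem ratToUnitInterval_injective : Function.Injective ratToUnitInterval := fun _ _ h =>
  Subtype.ext (Rat.cast_injective (α := ℝ) (congrArg Subtype.val h))

theorem springborn_jump_ratToUnitInterval {r : Icc (0 : ℚ) 1} (hr : ratToUnitInterval r < 1) :
    Function.rightLim springborn (ratToUnitInterval r) -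
      Function.leftLim springborn (ratToUnitInterval r) =
      gapWeight r - if (r : ℚ) = 0 then gapLength 1 / 2 else 0 := by
  rw [springborn_jump hr]
  congr 1
  · rw [tsum_eq_single r]
    · simp [ratToUnitInterval]
    · intro s hs
      have : ¬ ((s : ℚ) : ℝ) = ratToUnitInterval r := fun h =>
        hs (ratToUnitInterval_injective (Subtype.ext h))
      rw [if_neg this, mul_zero]
  · have : ratToUnitInterval r = 0 ↔ (r : ℚ) = 0 := by
      rw [Subtype.ext_iff]
      exact Rat.cast_eq_zero
    simp only [this]

theorem springborn_jump_of_irrational {y : unitInterval} (hy : Irrational (y : ℝ)) :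
    Function.rightLim springborn y - Function.leftLim springborn y = 0 := by
  have h1 : y < 1 := lt_of_le_of_ne y.2.2 fun h => hy.ne_one (by rw [h]; rfl)
  have h0 : y ≠ 0 := fun h => hy.ne_zero (by rw [h]; rfl)
  rw [springborn_jump h1, if_neg h0, sub_zero]
  refine (tsum_congr fun r => ?_).trans tsum_zero
  rw [if_neg fun h => hy ⟨r, h⟩, mul_zero]

theorem tsum_springborn_jump {x : unitInterval} (hx : 0 < x) :
    (∑' y : Iio x, (Function.rightLim springborn (y : unitInterval) -
      Function.leftLim springborn (y : unitInterval))) =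
      (∑' r : Icc (0 : ℚ) 1, gapWeight r * (if ((r : ℚ) : ℝ) < x then 1 else 0)) -
        gapLength 1 / 2 := by
  rw [tsum_subtype (Iio x) fun y => Function.rightLim springborn y - Function.leftLim springborn y,
    ← ratToUnitInterval_injective.tsum_eq]
  · refine (tsum_congr fun r => ?_).trans ((summable_gapWeight_ite _).hasSum.sub
      (hasSum_ite_coe_eq (x := 0) (by simp) fun _ => gapLength 1 / 2)).tsum_eq
    by_cases h : ratToUnitInterval r < x
    · have h' : ((r : ℚ) : ℝ) < x := h
      rw [indicator_of_mem (mem_Iio.2 h),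
        springborn_jump_ratToUnitInterval (h.trans_le x.2.2), if_pos h', mul_one]
    · have h' : ¬ ((r : ℚ) : ℝ) < x := h
      have h0 : (r : ℚ) ≠ 0 := fun h0 => h' (by rw [h0, Rat.cast_zero]; exact hx)
      rw [indicator_of_notMem (show ratToUnitInterval r ∉ Iio x from h), if_neg h', if_neg h0, mul_zero, sub_zero]
  · intro y hy
    by_contra hr
    refine hy ?_
    have hirr : Irrational (y : ℝ) := by
      rintro ⟨q, hq⟩
      exact hr ⟨⟨q, by exact_mod_cast hq ▸ y.2.1, by exact_mod_cast hq ▸ y.2.2⟩, Subtype.ext hq⟩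
    rw [indicator_apply, springborn_jump_of_irrational hirr, ite_self]

theorem saltus_springborn (x : unitInterval) : saltus springborn x = springborn x := by
  rcases unitInterval.nonneg'.eq_or_lt (b := x) with rfl | hx
  · have : IsEmpty (Iio (0 : unitInterval)) := ⟨fun y => y.2.not_ge unitInterval.nonneg'⟩
    rw [saltus, tsum_empty, leftLim_springborn_zero, sub_zero, add_zero]
  · rw [saltus, tsum_springborn_jump hx, leftLim_springborn hx]
    ring

theorem proposition4p1 :
    StrictMono springborn ∧
    (∀ x : unitInterval, Irrational (x : ℝ) →
      Tendsto (fun r : Icc (0 : ℚ) 1 => (springbornRat r : ℝ))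
        (comap (fun r : Icc (0 : ℚ) 1 => ((r : ℚ) : ℝ)) (𝓝 (x : ℝ))) (𝓝 (springborn x))) ∧
    ∀ x : unitInterval,
      springborn x = saltus springborn x ∧
      Summable (fun r : Icc (0 : ℚ) 1 =>
        gapLength (markovNumber r) * heaviside ((x : ℝ) - ((r : ℚ) : ℝ))) ∧
      saltus springborn x = -(1 / 2) * gapLength 1 +
        ∑' r : Icc (0 : ℚ) 1,
          gapLength (markovNumber r) * heaviside ((x : ℝ) - ((r : ℚ) : ℝ)) := by
  refine ⟨fun x y h => ?_, fun x hx => ?_, fun x => ⟨(saltus_springborn x).symm,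
    summable_jumpSeries x, ?_⟩⟩
  · rw [springborn_eq_jumpSeries, springborn_eq_jumpSeries]
    exact jumpSeries_lt x.2.1 y.2.2 h
  · rw [springborn_eq_jumpSeries]
    exact tendsto_springbornRat hx
  · rw [saltus_springborn, springborn_eq_jumpSeries]
    rfl
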